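/- Let $P_l$ denote the path on $l$ vertices, let $(P_l)^t$ be the $t$-fold Cartesian power $P_l \times \dots \times P_l$, and let $Q_n$ be the hypercube graph on $\{0,1\}^n$. For all integers $l, t \ge 1$ there is a constant $C = C(l,t)$ such that for every $n \ge 1$ there is a collection of pairwise disjoint sets of vertices of $Q_n$, each of which induces in $Q_n$ a subgraph isomorphic to $(P_l)^t$, such that at most $C\, n^{t-1}$ vertices of $Q_n$ belong to none of these sets. -/

import Mathlib

namespace SimpleGraph

/-- The `n`-th Cartesian power `G □ ⋯ □ G` of a graph `G`: vertices are `n`-tuples of vertices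
of `G`; two tuples are adjacent iff they are adjacent in `G` in one coordinate and agree in all
other coordinates. -/
def cartesianPower {V : Type*} (G : SimpleGraph V) (n : ℕ) : SimpleGraph (Fin n → V) where
  Adj x y := ∃ i, G.Adj (x i) (y i) ∧ ∀ j, j ≠ i → x j = y j
  symm := ⟨fun _ _ ⟨i, hi, h⟩ => ⟨i, hi.symm, fun j hj => (h j hj).symm⟩⟩
  loopless := ⟨fun _ ⟨_, hi, _⟩ => hi.ne rfl⟩

/-- The hypercube `Q_n` on `{0,1}^n`: two vertices are adjacent iff they differ in exactly one
coordinate. -/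
def hypercube (n : ℕ) : SimpleGraph (Fin n → Bool) where
  Adj x y := hammingDist x y = 1
  symm := ⟨fun x y h => by rw [hammingDist_comm]; exact h⟩
  loopless := ⟨fun x h => by simp at h⟩

/-- `S` is the vertex set of an induced copy of `H` in `G`. -/
def IsInducedCopy {V W : Type*} (G : SimpleGraph V) (H : SimpleGraph W) (S : Set V) : Prop :=
  Nonempty (G.induce S ≃g H)

/-- `P` is (the collection of vertex sets of) a packing of `G` by induced copies of `H`: its
members are induced copies of `H` in `G`, and distinct members are vertex-disjoint. -/
def IsInducedPacking {V W : Type*} (G : SimpleGraph V) (H : SimpleGraph W)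
    (P : Set (Set V)) : Prop :=
  (∀ S ∈ P, IsInducedCopy G H S) ∧ P.PairwiseDisjoint id

end SimpleGraph

section CubePacking

open Function Set

/-! The core is one-dimensional: for some `m` and `C`, the product of the punctured cube `Q_m \ {0}`
with a cube on `C` splits into isometric paths on `l` vertices (`exists_pathTileable_nonzeroOn`).
Given this, cut `n` coordinates into blocks of size `m`, `t` copies of `C` and fewer than `m`
leftovers. Among the vertices with a fixed set of at least `t` nonzero blocks, join `t` of those
blocks to the copies of `C`; products of path tilings then give a tiling by grids. Only vertices
with fewer than `t` nonzero blocks remain, and there are `O(n^(t-1))` of them.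

For the core, let `V` be a punctured cube times a cube. Modulo `l`, twice the indicator of `V` is a
combination of path indicators (`two_smul_indicator_mem`). A finite elementary abelian 2-group `G`
of large order then indexes path-tileable sets `p g ⊆ V` such that each `y ∈ V` is missed by a
multiple of `l` of them. A syndrome map from a further cube to `G` turns this modular cover into an
exact tiling of a product (`PathTileable.prod_of_cover`), since preimages of syndrome sets of size
divisible by `l` are tiled by paths (`pathTileable_syndrome_preimage`). -/

/-- `U` is the disjoint union of the vertex sets of isometric paths on `l` vertices of the cube on
the coordinate set `B`. -/
def PathTileable (l : ℕ) {B : Type*} [Fintype B] (U : Set (B → Bool)) : Prop :=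
  ∃ (ι : Type) (p : ι × Fin l → B → Bool), Injective p ∧ range p = U ∧
    ∀ i a b, hammingDist (p (i, a)) (p (i, b)) = Nat.dist a b

/-! ### Translations and staircase paths in the cube. -/

section Translate

variable {J : Type*}

/-- The cubeTranslate of `w` by `y` in the cube, seen as an elementary abelian `2`-group. -/
def cubeTranslate (y w : J → Bool) : J → Bool := fun b => xor (y b) (w b)

theorem cubeTranslate_cubeTranslate (y w : J → Bool) : cubeTranslate (cubeTranslate y w) w = y := by
  funext b; simp [cubeTranslate]

theorem hammingDist_cubeTranslate [Fintype J] (y w w' : J → Bool) :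
    hammingDist (cubeTranslate y w) (cubeTranslate y w') = hammingDist w w' :=
  hammingDist_comp (fun b => xor (y b)) (fun b u v h => by simpa using h)

/-- The indicator of the first `i` of the directions `d`. -/
def stair [DecidableEq J] {n : ℕ} (d : Fin n → J) (i : ℕ) : J → Bool :=
  fun b => decide (∃ k : Fin n, d k = b ∧ (k : ℕ) < i)

theorem hammingDist_stair_of_le [Fintype J] [DecidableEq J] {n : ℕ} {d : Fin n → J}
    (hd : Injective d) {i j : ℕ} (hij : i ≤ j) (hj : j ≤ n) :
    hammingDist (stair d i) (stair d j) = j - i := by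
  rw [← Nat.card_Ico i j, hammingDist]
  symm
  refine Finset.card_bij (fun x hx => d ⟨x, (Finset.mem_Ico.1 hx).2.trans_le hj⟩) ?_ ?_ ?_
  · intro x hx
    have hx' := Finset.mem_Ico.1 hx
    have h1 : stair d i (d ⟨x, hx'.2.trans_le hj⟩) = false := by
      simp only [stair, decide_eq_false_iff_not, not_exists, not_and, not_lt]
      intro k hk
      rw [hd hk]; exact hx'.1
    have h2 : stair d j (d ⟨x, hx'.2.trans_le hj⟩) = true := by
      simp only [stair, decide_eq_true_eq]
      exact ⟨_, rfl, hx'.2⟩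
    simp [h1, h2]
  · intro x hx y hy h
    simpa using hd h
  · intro b hb
    simp only [Finset.mem_filter, Finset.mem_univ, true_and, stair, ne_eq, decide_eq_decide] at hb
    by_cases h : ∃ k : Fin n, d k = b ∧ (k : ℕ) < j
    · obtain ⟨k, rfl, hk⟩ := h
      refine ⟨k, Finset.mem_Ico.2 ⟨?_, hk⟩, rfl⟩
      by_contra hki
      exact hb ⟨fun _ => ⟨k, rfl, hk⟩, fun _ => ⟨k, rfl, not_le.1 hki⟩⟩
    · exact absurd ⟨fun ⟨k, h1, h2⟩ => ⟨k, h1, h2.trans_le hij⟩, fun h' => absurd h' h⟩ hb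

theorem hammingDist_stair [Fintype J] [DecidableEq J] {n : ℕ} {d : Fin n → J}
    (hd : Injective d) {i j : ℕ} (hi : i ≤ n) (hj : j ≤ n) :
    hammingDist (stair d i) (stair d j) = Nat.dist i j := by
  rcases le_total i j with h | h
  · rw [hammingDist_stair_of_le hd h hj, Nat.dist_eq_sub_of_le h]
  · rw [hammingDist_comm, hammingDist_stair_of_le hd h hi, Nat.dist_eq_sub_of_le_right h]

end Translate

namespace PathTileable

variable {l : ℕ} {B : Type*} [Fintype B]

theorem empty : PathTileable l (∅ : Set (B → Bool)) :=
  ⟨Empty, fun x => x.1.elim, fun x => x.1.elim, range_eq_empty_iff.2 ⟨fun x => x.1.elim⟩, fun i => i.elim⟩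

theorem range_path {q : Fin l → B → Bool}
    (hq : ∀ a b, hammingDist (q a) (q b) = Nat.dist a b) : PathTileable l (range q) := by
  refine ⟨Unit, fun x => q x.2, ?_, ?_, fun _ => hq⟩
  · rintro ⟨_, a⟩ ⟨_, b⟩ h
    have h0 := hq a b
    simp only at h
    rw [h, hammingDist_self] at h0
    rw [Fin.ext (Nat.eq_of_dist_eq_zero h0.symm)]
  · ext x; simp

theorem iUnion {κ : Type} {U : κ → Set (B → Bool)} (hU : ∀ k, PathTileable l (U k))
    (hd : ∀ k k' x, x ∈ U k → x ∈ U k' → k = k') : PathTileable l (⋃ k, U k) := by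
  choose ι p hp hr hi using hU
  refine ⟨Σ k, ι k, fun x => p x.1.1 (x.1.2, x.2), ?_, ?_, fun i => hi i.1 i.2⟩
  · rintro ⟨⟨k, i⟩, a⟩ ⟨⟨k', i'⟩, a'⟩ h
    simp only at h
    obtain rfl : k = k' := hd k k' (p k (i, a)) (hr k ▸ mem_range_self _)
      (h ▸ hr k' ▸ mem_range_self _)
    have := hp k h
    simp_all
  · ext x
    simp only [mem_iUnion, ← hr, mem_range, Prod.exists, Sigma.exists]

theorem union {U U' : Set (B → Bool)} (hU : PathTileable l U) (hU' : PathTileable l U')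
    (hd : Disjoint U U') : PathTileable l (U ∪ U') := by
  rw [union_eq_iUnion]
  refine iUnion (fun b => by cases b <;> assumption) ?_
  have := Set.disjoint_left.1 hd
  rintro (_ | _) (_ | _) x h h' <;> simp_all

theorem image {B' : Type*} [Fintype B'] {U : Set (B → Bool)} (hU : PathTileable l U)
    {h : (B → Bool) → B' → Bool} (hh : ∀ x y, hammingDist (h x) (h y) = hammingDist x y) :
    PathTileable l (h '' U) := by
  obtain ⟨ι, p, hp, rfl, hi⟩ := hU
  refine ⟨ι, h ∘ p, ?_, range_comp _ _, fun i a b => by simp [hh, hi]⟩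
  refine Injective.comp (fun x y hxy => ?_) hp
  rw [← hammingDist_eq_zero, ← hh, hxy, hammingDist_self]

end PathTileable

section Sum

variable {J K : Type*} [Fintype J] [Fintype K]

theorem hammingDist_sumElim (y y' : J → Bool) (x x' : K → Bool) :
    hammingDist (Sum.elim y x) (Sum.elim y' x') = hammingDist y y' + hammingDist x x' := by
  classical
  simp only [hammingDist, Finset.card_filter, Fintype.sum_sum_type, Sum.elim_inl, Sum.elim_inr]
  congr!

end Sum

/-! ### Tilings from syndromes in an elementary abelian 2-group. -/

section Syndrome

variable {G : Type} [AddCommGroup G] {l : ℕ}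

/-- The successive differences of a sequence, the first one being its first term. -/
def differences (a : Fin l → G) (k : Fin l) : G :=
  a k - if h : (k : ℕ) = 0 then 0 else a ⟨k - 1, by omega⟩

theorem sum_differences (a : Fin l → G) (i : Fin l) :
    (∑ k : Fin l, if (k : ℕ) < i + 1 then differences a k else 0) = a i := by
  -- Shifting the index by one puts `b 0 = 0` before the sequence, so the sum telescopes without a
  -- boundary case.
  let b : ℕ → G := fun k => if h : 0 < k ∧ k ≤ l then a ⟨k - 1, by omega⟩ else 0
  have hb : ∀ k : Fin l, differences a k = b (k + 1) - b k := by
    intro k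
    have := k.2
    simp only [differences, b]
    rw [dif_pos (show 0 < (k : ℕ) + 1 ∧ (k : ℕ) + 1 ≤ l by omega)]
    by_cases h : (k : ℕ) = 0
    · rw [dif_pos h, dif_neg (by omega)]; rfl
    · rw [dif_neg h, dif_pos (by omega)]; rfl
  simp only [hb]
  rw [Fin.sum_univ_eq_sum_range (fun k => if k < (i : ℕ) + 1 then b (k + 1) - b k else 0),
    ← Finset.sum_filter]
  have : (Finset.range l).filter (fun k => k < (i : ℕ) + 1) = Finset.range (i + 1) := by
    ext k; simp; omega
  rw [this, Finset.sum_range_sub]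
  simp [b]

variable [Fintype G]

/-- The sum of the labels `g` of the coordinates `(g, i)` at which `x` is `true`. -/
def syndrome (x : G × Fin l → Bool) : G := ∑ c, if x c then c.1 else 0

theorem syndrome_cubeTranslate (hG : ∀ g : G, g + g = 0) (x y : G × Fin l → Bool) :
    syndrome (cubeTranslate x y) = syndrome x + syndrome y := by
  rw [syndrome, syndrome, syndrome, ← Finset.sum_add_distrib]
  refine Finset.sum_congr rfl fun c _ => ?_
  cases hx : x c <;> cases hy : y c <;> simp [cubeTranslate, hx, hy, hG]

variable [DecidableEq G]

theorem syndrome_stair (D : Fin l → G) (i : ℕ) :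
    syndrome (stair (fun k => (D k, k)) i) = ∑ k : Fin l, if (k : ℕ) < i then D k else 0 := by
  rw [syndrome, Fintype.sum_prod_type_right]
  refine Finset.sum_congr rfl fun k _ => ?_
  have : ∀ g, stair (fun k => (D k, k)) i (g, k) = decide (D k = g ∧ (k : ℕ) < i) := by
    intro g
    simp only [stair, decide_eq_decide, Prod.mk.injEq]
    constructor
    · rintro ⟨k', ⟨h1, h3⟩, h2⟩; subst h3; exact ⟨h1, h2⟩
    · rintro ⟨h1, h2⟩; exact ⟨k, ⟨h1, rfl⟩, h2⟩
  simp only [this, decide_eq_true_eq, ite_and]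
  simp

/-- Cut `A` into `l`-tuples. For each tuple there is a staircase path whose vertices have exactly
these syndromes, and its translates by the kernel of `syndrome` tile the preimage of the tuple. Step
`k` uses direction `(differences a k, k)`; the second component keeps directions distinct when
differences repeat. -/
theorem pathTileable_syndrome_preimage (hG : ∀ g : G, g + g = 0) (A : Finset G)
    (hA : l ∣ A.card) : PathTileable l {x : G × Fin l → Bool | syndrome x ∈ A} := by
  obtain ⟨q, hq⟩ := hA
  have e : Fin q × Fin l ≃ A := Fintype.equivOfCardEq (by simp [hq, mul_comm])
  let a : Fin q → Fin l → G := fun s i => e (s, i)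
  let w : Fin q → Fin l → G × Fin l → Bool := fun s i =>
    -- The path begins after the first step: the base point has syndrome `0` and is not one of its
    -- vertices.
    stair (fun k => (differences (a s) k, k)) (i + 1)
  have hw : ∀ s i, syndrome (w s i) = a s i := fun s i => by
    simp only [w]; rw [syndrome_stair, sum_differences]
  have hp : ∀ (z : {z : G × Fin l → Bool // syndrome z = 0}) s i,
      syndrome (cubeTranslate z.1 (w s i)) = a s i := fun z s i => by
    rw [syndrome_cubeTranslate hG, z.2, hw, zero_add]
  refine ⟨Fin q × {z : G × Fin l → Bool // syndrome z = 0},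
    fun x => cubeTranslate x.1.2.1 (w x.1.1 x.2), ?_, ?_, ?_⟩
  · rintro ⟨⟨s, z⟩, i⟩ ⟨⟨s', z'⟩, i'⟩ h
    have h1 : a s i = a s' i' := by rw [← hp z, ← hp z']; exact congrArg syndrome h
    have h2 := e.injective (Subtype.ext h1)
    obtain ⟨rfl, rfl⟩ := Prod.mk.inj h2
    have h3 : z = z' := by
      apply Subtype.ext
      rw [← cubeTranslate_cubeTranslate z.1 (w s i), ← cubeTranslate_cubeTranslate z'.1 (w s i)]
      exact congrArg (fun x => cubeTranslate x (w s i)) h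
    rw [h3]
  · ext x
    constructor
    · rintro ⟨⟨⟨s, z⟩, i⟩, rfl⟩
      simp only [mem_ofPred_eq, hp]
      exact (e (s, i)).2
    · intro hx
      obtain ⟨⟨s, i⟩, hsi⟩ := e.surjective ⟨syndrome x, hx⟩
      have hsi' : a s i = syndrome x := congrArg Subtype.val hsi
      refine ⟨⟨⟨s, cubeTranslate x (w s i), ?_⟩, i⟩, cubeTranslate_cubeTranslate _ _⟩
      rw [syndrome_cubeTranslate hG, hw, hsi', hG]
  · rintro ⟨s, z⟩ i j
    simp only [hammingDist_cubeTranslate, w]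
    rw [hammingDist_stair (fun k k' h => (Prod.mk.inj h).2) (by omega) (by omega)]
    simp [Nat.dist]

/-- If for every `y ∈ V` the number of `g` with `y ∉ p g` is a multiple of `l`, then `V × Q` is
tiled: the fibre over `x` is tiled within `p (syndrome x)`, and the remainder of the fibre over `y`
is the preimage of a set of syndromes. -/
theorem PathTileable.prod_of_cover {J : Type} [Fintype J] (hG : ∀ g : G, g + g = 0)
    (V : Set (J → Bool)) (p : G → Set (J → Bool)) (hp : ∀ g, PathTileable l (p g))
    (hpV : ∀ g, p g ⊆ V) (A : (J → Bool) → Finset G) (hA : ∀ y g, g ∈ A y ↔ y ∉ p g)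
    (hcard : ∀ y ∈ V, l ∣ (A y).card) :
    PathTileable l {z : J ⊕ (G × Fin l) → Bool | z ∘ Sum.inl ∈ V} := by
  have h1 : PathTileable l (⋃ x : G × Fin l → Bool, (fun y => Sum.elim y x) '' p (syndrome x)) := by
    refine .iUnion (fun x => (hp _).image fun y y' => by simp [hammingDist_sumElim]) ?_
    rintro x x' _ ⟨y, -, rfl⟩ ⟨y', -, h⟩
    exact (congrArg (fun z => z ∘ Sum.inr) h).symm
  have h2 : PathTileable l (⋃ y : V,
      (fun x : G × Fin l → Bool => Sum.elim y.1 x) '' {x | syndrome x ∈ A y}) := by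
    refine .iUnion (fun y => (pathTileable_syndrome_preimage hG (A y) (hcard _ y.2)).image
      fun x x' => by simp [hammingDist_sumElim]) ?_
    rintro y y' _ ⟨x, -, rfl⟩ ⟨x', -, h⟩
    exact Subtype.ext (congrArg (fun z => z ∘ Sum.inl) h).symm
  have h12 := h1.union h2 (by
    rw [Set.disjoint_left]
    intro z hz hz'
    simp only [mem_iUnion, mem_image] at hz hz'
    obtain ⟨x, y, hy, rfl⟩ := hz
    obtain ⟨y', x', hx, h⟩ := hz'
    obtain rfl : y'.1 = y := congrArg (fun z => z ∘ Sum.inl) h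
    obtain rfl : x' = x := congrArg (fun z => z ∘ Sum.inr) h
    exact (hA _ _).1 hx hy)
  convert h12 using 1
  ext z
  simp only [mem_ofPred_eq, mem_union, mem_iUnion, mem_image]
  constructor
  · intro hz
    by_cases hzp : z ∘ Sum.inl ∈ p (syndrome (z ∘ Sum.inr))
    · exact .inl ⟨z ∘ Sum.inr, _, hzp, Sum.elim_comp_inl_inr z⟩
    · exact .inr ⟨⟨_, hz⟩, z ∘ Sum.inr, (hA _ _).2 hzp, Sum.elim_comp_inl_inr z⟩
  · rintro (⟨x, y, hy, rfl⟩ | ⟨y, x, -, rfl⟩)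
    · exact hpV _ hy
    · exact y.2

end Syndrome

section Flip

variable {J : Type*} [DecidableEq J]

/-- The neighbour of `y` in direction `i`. -/
def flipAt (i : J) (y : J → Bool) : J → Bool := update y i (!y i)

@[simp] theorem flipAt_apply_self (i : J) (y : J → Bool) : flipAt i y i = !y i := update_self ..

theorem flipAt_apply_of_ne {i b : J} (h : b ≠ i) (y : J → Bool) : flipAt i y b = y b :=
  update_of_ne h ..

@[simp] theorem flipAt_flipAt (i : J) (y : J → Bool) : flipAt i (flipAt i y) = y := by
  simp [flipAt]

theorem flipAt_comm (i j : J) (y : J → Bool) : flipAt i (flipAt j y) = flipAt j (flipAt i y) := by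
  rcases eq_or_ne i j with rfl | h
  · rfl
  · simp only [flipAt, update_of_ne h, update_of_ne h.symm]
    rw [update_comm h]

end Flip

/-! ### Path indicators modulo `l`. -/

section PathSpan

variable {J : Type*} [Fintype J]

/-- The isometric paths on `l` vertices inside the set `V` of vertices of the cube. -/
abbrev PathsIn (l : ℕ) (V : Set (J → Bool)) : Type _ :=
  {q : Fin l → J → Bool // (∀ a b, hammingDist (q a) (q b) = Nat.dist a b) ∧ ∀ i, q i ∈ V}

/-- The indicator of a vertex, with values in `ZMod l`. -/
def vertexInd (l : ℕ) (y : J → Bool) : (J → Bool) → ZMod l := Pi.single y 1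

/-- The span of the indicators of isometric paths on `l` vertices inside `V`. -/
def pathSpan (l : ℕ) (V : Set (J → Bool)) : Submodule (ZMod l) ((J → Bool) → ZMod l) :=
  Submodule.span _ (range fun q : PathsIn l V => ∑ i, vertexInd l (q.1 i))

variable {l : ℕ} {V : Set (J → Bool)}

/-- Dropping the last or the first vertex of a path on `l + 1` vertices leaves two paths on `l`
vertices, whose indicators differ by the two ends. -/
theorem vertexInd_sub_mem_pathSpan {q : Fin (l + 1) → J → Bool}
    (hq : ∀ a b, hammingDist (q a) (q b) = Nat.dist a b) (hV : ∀ i, q i ∈ V) :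
    vertexInd l (q 0) - vertexInd l (q (Fin.last l)) ∈ pathSpan l V := by
  have h1 : ∑ i : Fin l, vertexInd l (q i.castSucc) ∈ pathSpan l V :=
    Submodule.subset_span ⟨⟨fun i => q i.castSucc, fun a b => by simp [hq], fun i => hV _⟩, rfl⟩
  have h2 : ∑ i : Fin l, vertexInd l (q i.succ) ∈ pathSpan l V :=
    Submodule.subset_span
      ⟨⟨fun i => q i.succ, fun a b => by simp [hq, Nat.dist], fun i => hV _⟩, rfl⟩
  have h3 := Fin.sum_univ_castSucc fun i => vertexInd l (q i)
  rw [Fin.sum_univ_succ] at h3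
  convert (pathSpan l V).sub_mem h1 h2 using 1
  rw [sub_eq_sub_iff_add_eq_add, h3]

variable [DecidableEq J]

theorem vertexInd_sub_stair_mem_pathSpan {y : J → Bool} {d : Fin l → J} (hd : Injective d)
    (hV : ∀ i, cubeTranslate y (stair d i) ∈ V) :
    vertexInd l y - vertexInd l (cubeTranslate y (stair d l)) ∈ pathSpan l V := by
  have h := vertexInd_sub_mem_pathSpan (l := l) (V := V)
    (q := fun i : Fin (l + 1) => cubeTranslate y (stair d i))
    (fun a b => by
      rw [hammingDist_cubeTranslate, hammingDist_stair hd (by omega) (by omega)])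
    (fun i => hV i)
  convert h using 3
  · funext b
    simp [cubeTranslate, stair]
  · rfl

end PathSpan

/-! ### Twice the indicator of the punctured product lies in the path span. -/

section Cover

variable {A C : Type*} [Fintype A] [Fintype C] [DecidableEq A] [DecidableEq C]

/-- The vertices of the cube that do not vanish on the coordinates in `A`. -/
def nonzeroOn (A C : Type*) : Set (A ⊕ C → Bool) := {y | ∃ a, y (Sum.inl a) = true}

/-- Walk from `y` along `i` and from the flipped vertex along `z`, then from both along the same `k`
fresh directions of `C`: the walks end at the same vertex. They stay in `nonzeroOn A C` because a
true coordinate `a` of `y` is never flipped. -/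
theorem vertexInd_sub_flip_flip_mem {k : ℕ} (hC : k + 2 ≤ Fintype.card C) {z : C}
    {y : A ⊕ C → Bool} (hy : y ∈ nonzeroOn A C) {i : A ⊕ C} (hi : y i = false)
    (hiz : i ≠ Sum.inr z) :
    vertexInd (k + 1) y - vertexInd (k + 1) (flipAt (Sum.inr z) (flipAt i y)) ∈
      pathSpan (k + 1) (nonzeroOn A C) := by
  obtain ⟨a, ha⟩ := hy
  have hai : Sum.inl a ≠ i := by rintro rfl; simp [ha] at hi
  have hcard : Fintype.card (Fin k) ≤ Fintype.card {c : C // c ≠ z ∧ Sum.inr c ≠ i} := by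
    rw [Fintype.card_fin, Fintype.card_subtype]
    have h1 : (Finset.univ.filter fun c : C => ¬(c ≠ z ∧ Sum.inr c ≠ i)).card ≤ 2 := by
      rcases i with i | i
      · refine (Finset.card_le_card (t := {z}) fun c => ?_).trans (by simp)
        simp
      · refine (Finset.card_le_card (t := {z, i}) fun c => ?_).trans Finset.card_le_two
        simp; tauto
    have h2 := Finset.card_filter_add_card_filter_not (s := (Finset.univ : Finset C))
      (fun c : C => c ≠ z ∧ (Sum.inr c : A ⊕ C) ≠ i)
    rw [Finset.card_univ] at h2
    omega
  obtain ⟨e⟩ := Function.Embedding.nonempty_of_card_le hcard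
  have key : ∀ (j : A ⊕ C) (x : A ⊕ C → Bool), x (Sum.inl a) = true → j ≠ Sum.inl a →
      (∀ s, Sum.inr (e s).1 ≠ j) → vertexInd (k + 1) x - vertexInd (k + 1) (cubeTranslate x
        (stair (Fin.cons j fun s => Sum.inr (e s).1 : Fin (k + 1) → A ⊕ C) (k + 1))) ∈
        pathSpan (k + 1) (nonzeroOn A C) := by
    intro j x hx hj hej
    refine vertexInd_sub_stair_mem_pathSpan (Fin.cons_injective_iff.2 ⟨?_, ?_⟩) fun i => ⟨a, ?_⟩
    · rintro ⟨s, hs⟩; exact hej s hs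
    · intro s s' h
      exact e.injective (Subtype.ext (Sum.inr_injective h))
    · have : stair (Fin.cons j fun s => Sum.inr (e s).1 : Fin (k + 1) → A ⊕ C) i (Sum.inl a)
          = false := by
        simp only [stair, decide_eq_false_iff_not, not_exists, not_and]
        intro s
        refine Fin.cases (fun h => absurd h hj) (fun s h => ?_) s
        simp at h
      simp [cubeTranslate, this, hx]
  have h1 := key i y ha hai.symm fun s => (e s).2.2
  have h2 := key (Sum.inr z) (flipAt (Sum.inr z) (flipAt i y))
    (by rw [flipAt_apply_of_ne (by simp), flipAt_apply_of_ne hai, ha]) (by simp)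
    fun s h => (e s).2.1 (Sum.inr_injective h)
  convert (pathSpan (k + 1) (nonzeroOn A C)).sub_mem h1 h2 using 1
  have hst : ∀ (j b : A ⊕ C), stair (Fin.cons j fun s => Sum.inr (e s).1 : Fin (k + 1) → A ⊕ C)
      (k + 1) b = decide (j = b ∨ ∃ s, (Sum.inr (e s).1 : A ⊕ C) = b) := by
    intro j b
    simp only [stair, Fin.exists_fin_succ, Fin.cons_zero, Fin.cons_succ, Fin.is_lt, and_true]
  have : cubeTranslate y (stair (Fin.cons i fun s => Sum.inr (e s).1 : Fin (k + 1) → A ⊕ C)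
      (k + 1)) = cubeTranslate (flipAt (Sum.inr z) (flipAt i y))
      (stair (Fin.cons (Sum.inr z) fun s => Sum.inr (e s).1 : Fin (k + 1) → A ⊕ C) (k + 1)) := by
    funext b
    simp only [cubeTranslate, hst]
    have hei : ¬ ∃ s, (Sum.inr (e s).1 : A ⊕ C) = i := fun ⟨s, hs⟩ => (e s).2.2 hs
    have hez : ¬ ∃ s, (Sum.inr (e s).1 : A ⊕ C) = Sum.inr z :=
      fun ⟨s, hs⟩ => (e s).2.1 (Sum.inr_injective hs)
    by_cases hbi : b = i
    · subst hbi
      rw [flipAt_apply_of_ne hiz, flipAt_apply_self]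
      simp [hei, hiz.symm]
    · by_cases hbz : b = Sum.inr z
      · subst hbz
        rw [flipAt_apply_self, flipAt_apply_of_ne hiz.symm]
        simp only [hez, hiz, or_false, decide_false, decide_true]
        simp
      · rw [flipAt_apply_of_ne hbz, flipAt_apply_of_ne hbi]
        simp [Ne.symm hbi, Ne.symm hbz]
  rw [this]
  abel

/-- The indicator of the edge at `y` in direction `z`. -/
def edgeInd (l : ℕ) (z : C) (y : A ⊕ C → Bool) : (A ⊕ C → Bool) → ZMod l :=
  vertexInd l y + vertexInd l (flipAt (Sum.inr z) y)

/-- The opposite corners of the square in directions `i` and `z` are congruent modulo the span, so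
its two edges in direction `z` are too. -/
theorem edgeInd_sub_flip_mem {k : ℕ} (hC : k + 2 ≤ Fintype.card C) {z : C}
    {y : A ⊕ C → Bool} (hy : y ∈ nonzeroOn A C) {i : A ⊕ C} (hi : y i = false) :
    edgeInd (k + 1) z y - edgeInd (k + 1) z (flipAt i y) ∈ pathSpan (k + 1) (nonzeroOn A C) := by
  by_cases hiz : i = Sum.inr z
  · subst hiz
    simp [edgeInd, add_comm]
  · have h1 := vertexInd_sub_flip_flip_mem hC (z := z) hy hi hiz
    obtain ⟨a, ha⟩ := hy
    have h2 := vertexInd_sub_flip_flip_mem hC (z := z) (y := flipAt (Sum.inr z) y)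
      ⟨a, by rwa [flipAt_apply_of_ne (by simp)]⟩ (i := i) (by rwa [flipAt_apply_of_ne hiz]) hiz
    rw [flipAt_comm i, flipAt_flipAt] at h2
    convert (pathSpan (k + 1) (nonzeroOn A C)).add_mem h1 h2 using 1
    simp only [edgeInd]
    abel

theorem edgeInd_sub_top_mem {k : ℕ} (hC : k + 2 ≤ Fintype.card C) (z : C)
    (y : A ⊕ C → Bool) (hy : y ∈ nonzeroOn A C) :
    edgeInd (k + 1) z y - edgeInd (k + 1) z (fun _ => true) ∈
      pathSpan (k + 1) (nonzeroOn A C) := by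
  induction hn : (Finset.univ.filter fun b => y b = false).card generalizing y with
  | zero =>
    obtain rfl : y = fun _ => true := by
      funext b
      have := Finset.filter_eq_empty_iff.1 (Finset.card_eq_zero.1 hn) (Finset.mem_univ b)
      simpa using this
    simp
  | succ n ih =>
    obtain ⟨i, hi⟩ : (Finset.univ.filter fun b => y b = false).Nonempty := by
      rw [← Finset.card_pos]; omega
    have hi' := (Finset.mem_filter.1 hi).2
    have h1 := edgeInd_sub_flip_mem hC (z := z) hy hi'
    have h2 := ih (flipAt i y) ?_ ?_
    · convert (pathSpan (k + 1) (nonzeroOn A C)).add_mem h1 h2 using 1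
      abel
    · obtain ⟨a, ha⟩ := hy
      refine ⟨a, ?_⟩
      rw [flipAt_apply_of_ne, ha]
      rintro rfl; simp [ha] at hi'
    · have : (Finset.univ.filter fun b => flipAt i y b = false) =
          (Finset.univ.filter fun b => y b = false).erase i := by
        ext b
        by_cases hb : b = i
        · subst hb; simp [hi']
        · simp [hb, flipAt_apply_of_ne hb]
      rw [this, Finset.card_erase_of_mem hi, hn, Nat.add_sub_cancel]

instance : DecidablePred (· ∈ nonzeroOn A C) := fun y =>
  inferInstanceAs (Decidable (∃ a, y (Sum.inl a) = true))

theorem card_nonzeroOn : (Finset.univ.filter (· ∈ nonzeroOn A C)).card =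
    (2 ^ Fintype.card A - 1) * 2 ^ Fintype.card C := by
  have h := Finset.card_filter_add_card_filter_not (s := (Finset.univ : Finset (A ⊕ C → Bool)))
    (· ∈ nonzeroOn A C)
  have h2 : (Finset.univ.filter fun y => ¬ y ∈ nonzeroOn A C).card = 2 ^ Fintype.card C := by
    rw [← Fintype.card_bool, ← Fintype.card_fun, ← Finset.card_univ]
    symm
    refine Finset.card_bij (fun w _ => Sum.elim (fun _ => false) w) ?_ ?_ ?_
    · intro w _; simp [nonzeroOn]
    · intro w _ w' _ hw
      exact congrArg (fun z => z ∘ Sum.inr) hw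
    · intro y hy
      refine ⟨y ∘ Sum.inr, Finset.mem_univ _, ?_⟩
      simp only [nonzeroOn, Finset.mem_filter, Finset.mem_univ, true_and, mem_ofPred_eq,
        not_exists, Bool.not_eq_true] at hy
      funext b
      rcases b with a | c
      · simp [hy a]
      · rfl
  rw [h2] at h
  rw [Nat.sub_mul, one_mul, ← pow_add]
  have h3 : (Finset.univ : Finset (A ⊕ C → Bool)).card = 2 ^ (Fintype.card A + Fintype.card C) := by
    simp
  omega

/-- All edges in direction `z` are congruent to the top one. Summed over `V`, they count each vertex
twice, while the top edge appears `|V|` times, a multiple of `k + 1`. -/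
theorem two_smul_indicator_mem {k : ℕ} (hC : k + 2 ≤ Fintype.card C)
    (hdvd : k + 1 ∣ (2 ^ Fintype.card A - 1) * 2 ^ Fintype.card C) :
    (2 : ZMod (k + 1)) • (∑ y with y ∈ nonzeroOn A C, vertexInd (k + 1) y) ∈
      pathSpan (k + 1) (nonzeroOn A C) := by
  have : 0 < Fintype.card C := by omega
  obtain ⟨z⟩ := Fintype.card_pos_iff.1 this
  have h1 : ∑ y with y ∈ nonzeroOn A C, (edgeInd (k + 1) z y - edgeInd (k + 1) z fun _ => true) ∈
      pathSpan (k + 1) (nonzeroOn A C) :=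
    Submodule.sum_mem _ fun y hy => edgeInd_sub_top_mem hC z y (Finset.mem_filter.1 hy).2
  rw [Finset.sum_sub_distrib, Finset.sum_const, card_nonzeroOn,
    ← Nat.cast_smul_eq_nsmul (ZMod (k + 1)), (ZMod.natCast_eq_zero_iff _ _).2 hdvd, zero_smul,
    sub_zero] at h1
  convert h1 using 1
  simp only [edgeInd, Finset.sum_add_distrib]
  rw [two_smul]
  congr 1
  have hf : ∀ y, y ∈ nonzeroOn A C → flipAt (Sum.inr z) y ∈ nonzeroOn A C := by
    rintro y ⟨a, ha⟩
    exact ⟨a, by rwa [flipAt_apply_of_ne (by simp)]⟩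
  refine Finset.sum_nbij' (flipAt (Sum.inr z)) (flipAt (Sum.inr z)) ?_ ?_ ?_ ?_ ?_
  · simpa using hf
  · simpa using hf
  · simp
  · simp
  · simp

end Cover

/-! ### From the span to families of paths, and the choice of parameters. -/

section Realize

variable {J : Type} [Fintype J] {l : ℕ} {V : Set (J → Bool)}

theorem sum_vertexInd_path_apply (q : PathsIn l V) (y : J → Bool) [Decidable (y ∈ range q.1)] :
    (∑ i, vertexInd l (q.1 i)) y = if y ∈ range q.1 then 1 else 0 := by
  rw [Finset.sum_apply]
  split_ifs with h
  · obtain ⟨i, rfl⟩ := h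
    rw [Finset.sum_eq_single i]
    · simp [vertexInd]
    · intro j _ hj
      rw [vertexInd, Pi.single_apply, if_neg]
      intro h
      have := q.2.1 i j
      rw [h, hammingDist_self] at this
      exact hj (Fin.ext (Nat.eq_of_dist_eq_zero this.symm)).symm
    · simp
  · refine Finset.sum_eq_zero fun i _ => ?_
    rw [vertexInd, Pi.single_apply, if_neg]
    rintro rfl
    exact h ⟨i, rfl⟩

/-- A vector of the path span is the reduction of a multiset of paths, which can be indexed by any
large enough set. -/
theorem exists_family_of_mem_pathSpan [NeZero l] {G : Type} [Fintype G]
    (hG : Nat.card (PathsIn l V × Fin l) ≤ Fintype.card G) {f : (J → Bool) → ZMod l}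
    (hf : f ∈ pathSpan l V) :
    ∃ p : G → Set (J → Bool), (∀ g, PathTileable l (p g)) ∧ (∀ g, p g ⊆ V) ∧
      ∀ y, ((Nat.card {g // y ∈ p g} : ℕ) : ZMod l) = f y := by
  classical
  obtain ⟨c, rfl⟩ := (Submodule.mem_span_range_iff_exists_fun _).1 hf
  rw [Nat.card_eq_fintype_card] at hG
  obtain ⟨e⟩ := Function.Embedding.nonempty_of_card_le hG
  -- The pair `(q, j)` stands for the `j`-th copy of `q`, used when `j` is below the coefficient of
  -- `q`; every other index gets the empty set.
  refine ⟨fun g => {y | ∃ x, e x = g ∧ (x.2 : ℕ) < (c x.1).val ∧ y ∈ range x.1.1}, ?_, ?_, ?_⟩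
  · intro g
    by_cases h : ∃ x, e x = g ∧ (x.2 : ℕ) < (c x.1).val
    · obtain ⟨x, rfl, hx⟩ := h
      convert PathTileable.range_path x.1.2.1 using 1
      ext y
      constructor
      · rintro ⟨x', h1, -, h3⟩
        rwa [e.injective h1] at h3
      · intro hy
        exact ⟨x, rfl, hx, hy⟩
    · convert PathTileable.empty (l := l) (B := J) using 1
      ext y
      simp only [mem_ofPred_eq, mem_empty_iff_false, iff_false]
      rintro ⟨x, h1, h2, -⟩
      exact h ⟨x, h1, h2⟩
  · rintro g _ ⟨x, -, -, i, rfl⟩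
    exact x.1.2.2 i
  · intro y
    have h1 : Nat.card {g // ∃ x, e x = g ∧ (x.2 : ℕ) < (c x.1).val ∧ y ∈ range x.1.1} =
        (Finset.univ.filter fun x : PathsIn l V × Fin l =>
          (x.2 : ℕ) < (c x.1).val ∧ y ∈ range x.1.1).card := by
      rw [Nat.card_eq_fintype_card, Fintype.card_subtype, ← Finset.card_map e]
      congr 1
      ext g
      simp only [Finset.mem_filter, Finset.mem_univ, true_and, Finset.mem_map]
      exact ⟨fun ⟨x, h, h'⟩ => ⟨x, h', h⟩, fun ⟨x, h, h'⟩ => ⟨x, h', h⟩⟩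
    simp only [mem_ofPred_eq]
    rw [h1, Finset.card_filter, Fintype.sum_prod_type, Finset.sum_apply, Nat.cast_sum]
    refine Finset.sum_congr rfl fun q _ => ?_
    rw [Pi.smul_apply, sum_vertexInd_path_apply]
    by_cases hy : y ∈ range q.1
    · simp only [hy, and_true, if_true, smul_eq_mul, mul_one]
      rw [← Finset.card_filter, Fin.card_filter_val_lt, min_eq_right (ZMod.val_lt _).le,
        ZMod.natCast_zmod_val]
    · simp [hy]

end Realize

/-- Euler's theorem handles the odd part of `l`, and `2 ^ c` absorbs its power of two. -/
theorem exists_dvd_two_pow_sub_one_mul (l c : ℕ) (hl : 1 ≤ l) (hc : l ≤ c) :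
    ∃ m, 1 ≤ m ∧ l ∣ (2 ^ m - 1) * 2 ^ c := by
  obtain ⟨a, b, hb, rfl⟩ := Nat.exists_eq_two_pow_mul_odd (n := l) (by omega)
  refine ⟨b.totient, Nat.totient_pos.2 hb.pos, ?_⟩
  rw [mul_comm]
  refine Nat.mul_dvd_mul ?_ (pow_dvd_pow _ ?_)
  · exact (Nat.modEq_iff_dvd' Nat.one_le_two_pow).1
      (Nat.ModEq.pow_totient (Nat.coprime_two_left.2 hb)).symm
  · exact (Nat.lt_two_pow_self.le.trans (Nat.le_mul_of_pos_right _ hb.pos)).trans hc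

/-- For some `m ≥ 1`, the cube of dimension `m` without a vertex, multiplied by a large cube, is
tiled by isometric paths on `l` vertices. -/
theorem exists_pathTileable_nonzeroOn (l : ℕ) (hl : 1 ≤ l) :
    ∃ (m : ℕ) (C : Type) (_ : Fintype C), 1 ≤ m ∧ PathTileable l (nonzeroOn (Fin m) C) := by
  obtain ⟨k, rfl⟩ : ∃ k, l = k + 1 := ⟨l - 1, by omega⟩
  obtain ⟨m, hm, hdvd⟩ := exists_dvd_two_pow_sub_one_mul (k + 1) (k + 2) hl (by omega)
  let V := nonzeroOn (Fin m) (Fin (k + 2))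
  let s := Nat.card (PathsIn (k + 1) V × Fin (k + 1))
  -- The order `2 ^ s * 2` exceeds the number `s` of indices needed, and its factor `2` matches the
  -- doubled indicator: each `y ∈ V` is covered `|G|` times modulo `k + 1`.
  let G := Fin (s + 1) → ZMod 2
  have hcG : Fintype.card G = 2 ^ s * 2 := by simp [G, pow_succ]
  have h2 := two_smul_indicator_mem (A := Fin m) (C := Fin (k + 2)) (k := k) (by simp)
    (by simpa using hdvd)
  have h3 := Submodule.smul_mem _ ((2 ^ s : ℕ) : ZMod (k + 1)) h2
  obtain ⟨p, hp, hpV, hpc⟩ := exists_family_of_mem_pathSpan (G := G) (by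
    rw [hcG]; have : s < 2 ^ s := Nat.lt_two_pow_self
    exact (show s ≤ 2 ^ s * 2 by omega)) h3
  have ht := PathTileable.prod_of_cover (G := G) (l := k + 1)
    (fun g => funext fun i => CharTwo.add_self_eq_zero (g i)) V p hp hpV
    (fun y => by classical exact Finset.univ.filter fun g => y ∉ p g) (by simp) (by
      classical
      intro y hy
      have h4 := Finset.card_filter_add_card_filter_not (s := (Finset.univ : Finset G))
        (fun g => y ∈ p g)
      have h5 := hpc y
      rw [Nat.card_eq_fintype_card, Fintype.card_subtype, smul_smul, Pi.smul_apply,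
        Finset.sum_apply] at h5
      simp only [vertexInd, Pi.single_apply] at h5
      rw [Finset.sum_ite_eq, if_pos (by simpa using hy), smul_eq_mul, mul_one] at h5
      rw [← ZMod.natCast_eq_zero_iff]
      rw [Finset.card_univ, hcG] at h4
      have h6 := congrArg (Nat.cast : ℕ → ZMod (k + 1)) h4
      rw [Nat.cast_add, h5] at h6
      push_cast at h6 ⊢
      simpa using h6)
  obtain ⟨ι, q, hq, hr, hi⟩ := ht
  let σ := Equiv.sumAssoc (Fin m) (Fin (k + 2)) (G × Fin (k + 1))
  refine ⟨m, Fin (k + 2) ⊕ (G × Fin (k + 1)), inferInstance, hm, ι, fun x => q x ∘ σ.symm,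
    ?_, ?_, ?_⟩
  · exact (σ.symm.surjective.injective_comp_right).comp hq
  · ext y
    have : y ∘ σ ∈ range q ↔ y ∈ nonzeroOn (Fin m) (Fin (k + 2) ⊕ (G × Fin (k + 1))) := by
      rw [hr]; rfl
    rw [← this]
    constructor
    · rintro ⟨x, rfl⟩
      exact ⟨x, by ext b; simp⟩
    · rintro ⟨x, hx⟩
      exact ⟨x, by ext b; simp [hx]⟩
  · intro i a b
    rw [← hi i a b]
    simp only [hammingDist]
    refine Finset.card_equiv σ.symm ?_
    simp

/-! ### Products of path tilings. -/

section Grid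

variable {I B : Type*} {t : ℕ}

/-- The vertex `x` with the block of coordinates `e (k, ·)` replaced by `w k`, for all `k`. -/
noncomputable def glue (e : Fin t × B ↪ I) (x : I → Bool) (w : Fin t → B → Bool) : I → Bool :=
  extend e (fun kb => w kb.1 kb.2) x

theorem glue_apply (e : Fin t × B ↪ I) (x : I → Bool) (w : Fin t → B → Bool) (k : Fin t) (b : B) :
    glue e x w (e (k, b)) = w k b :=
  e.injective.extend_apply _ _ (k, b)

theorem glue_apply_of_notMem (e : Fin t × B ↪ I) (x : I → Bool) (w : Fin t → B → Bool) {i : I}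
    (hi : i ∉ range e) : glue e x w i = x i :=
  extend_apply' _ _ _ hi

theorem glue_congr (e : Fin t × B ↪ I) {x x' : I → Bool} (h : ∀ i ∉ range e, x i = x' i)
    (w : Fin t → B → Bool) : glue e x w = glue e x' w := by
  funext i
  by_cases hi : i ∈ range e
  · obtain ⟨⟨k, b⟩, rfl⟩ := hi
    rw [glue_apply, glue_apply]
  · rw [glue_apply_of_notMem e _ _ hi, glue_apply_of_notMem e _ _ hi, h i hi]

theorem hammingDist_glue [Fintype I] [Fintype B] (e : Fin t × B ↪ I) (x : I → Bool)
    (w w' : Fin t → B → Bool) :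
    hammingDist (glue e x w) (glue e x w') = ∑ k, hammingDist (w k) (w' k) := by
  classical
  have : (Finset.univ.filter fun i => glue e x w i ≠ glue e x w' i) =
      (Finset.univ.filter fun kb : Fin t × B => w kb.1 kb.2 ≠ w' kb.1 kb.2).map e := by
    ext i
    simp only [Finset.mem_filter, Finset.mem_univ, true_and, Finset.mem_map]
    constructor
    · intro h
      by_cases hi : i ∈ range e
      · obtain ⟨⟨k, b⟩, rfl⟩ := hi
        rw [glue_apply, glue_apply] at h
        exact ⟨_, h, rfl⟩
      · rw [glue_apply_of_notMem e _ _ hi, glue_apply_of_notMem e _ _ hi] at h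
        exact absurd rfl h
    · rintro ⟨⟨k, b⟩, h, rfl⟩
      rwa [glue_apply, glue_apply]
  rw [hammingDist, this, Finset.card_map, Finset.card_filter, Fintype.sum_prod_type]
  simp [hammingDist, Finset.card_filter]

/-- `S` is a disjoint union of isometric copies of the grid `{0, …, l - 1}^t`. -/
def GridTileable [Fintype I] (l t : ℕ) (S : Set (I → Bool)) : Prop :=
  ∃ P : Set (Set (I → Bool)),
    (∀ s ∈ P, ∃ f : (Fin t → Fin l) → I → Bool,
      (∀ u v, hammingDist (f u) (f v) = ∑ k, Nat.dist (u k) (v k)) ∧ range f = s) ∧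
    P.PairwiseDisjoint id ∧ ⋃₀ P = S

theorem GridTileable.iUnion [Fintype I] {l : ℕ} {κ : Type*} {S : κ → Set (I → Bool)}
    (hS : ∀ k, GridTileable l t (S k)) (hd : ∀ k k' x, x ∈ S k → x ∈ S k' → k = k') :
    GridTileable l t (⋃ k, S k) := by
  choose P hP hPd hPu using hS
  refine ⟨⋃ k, P k, ?_, ?_, ?_⟩
  · intro s hs
    obtain ⟨k, hk⟩ := mem_iUnion.1 hs
    exact hP k s hk
  · intro s hs s' hs' hne
    obtain ⟨k, hk⟩ := mem_iUnion.1 hs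
    obtain ⟨k', hk'⟩ := mem_iUnion.1 hs'
    by_cases h : k = k'
    · subst h
      exact hPd k hk hk' hne
    · refine Set.disjoint_left.2 fun x hx hx' => h (hd k k' x ?_ ?_)
      · rw [← hPu]; exact ⟨s, hk, hx⟩
      · rw [← hPu]; exact ⟨s', hk', hx'⟩
  · rw [sUnion_iUnion]
    exact iUnion_congr hPu

/-- If membership in `S` forces `t` disjoint blocks of coordinates to lie in a set `U` tiled by
paths, and imposes no other condition on these blocks, then `S` is tiled by grids. -/
theorem PathTileable.gridTileable [Fintype I] [Fintype B] {l : ℕ} {U : Set (B → Bool)}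
    (hU : PathTileable l U) (e : Fin t × B ↪ I) {S : Set (I → Bool)}
    (hS : ∀ x ∈ S, ∀ k, (fun b => x (e (k, b))) ∈ U)
    (hS' : ∀ x ∈ S, ∀ w : Fin t → B → Bool, (∀ k, w k ∈ U) → glue e x w ∈ S) :
    GridTileable l t S := by
  obtain ⟨ι, p, hp, rfl, hi⟩ := hU
  let F : (I → Bool) → (Fin t → ι) → (Fin t → Fin l) → I → Bool :=
    fun x i u => glue e x fun k => p (i k, u k)
  refine ⟨{s | ∃ x ∈ S, ∃ i, range (F x i) = s}, ?_, ?_, ?_⟩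
  · rintro _ ⟨x, -, i, rfl⟩
    refine ⟨F x i, fun u v => ?_, rfl⟩
    simp only [F, hammingDist_glue, hi]
  · rintro _ ⟨x, -, i, rfl⟩ _ ⟨x', -, i', rfl⟩ hne
    refine Set.disjoint_left.2 ?_
    rintro _ ⟨u, rfl⟩ ⟨u', h⟩
    refine hne (congrArg range ?_)
    -- Different `x` may give the same grid. A common vertex forces equal path indices and agreement
    -- off the blocks, hence equal grids.
    have hii : i = i' := by
      funext k
      have : p (i' k, u' k) = p (i k, u k) := by
        funext b
        have := congrFun h (e (k, b))
        simpa only [F, glue_apply] using this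
      exact (Prod.mk.inj (hp this)).1.symm
    subst hii
    funext v
    refine glue_congr e (fun j hj => ?_) _
    have := congrFun h j
    simp only [F, glue_apply_of_notMem e _ _ hj] at this
    exact this.symm
  · ext x
    constructor
    · rintro ⟨_, ⟨x, hx, i, rfl⟩, u, rfl⟩
      exact hS' x hx _ fun k => mem_range_self _
    · intro hx
      choose q hq using hS x hx
      refine ⟨_, ⟨x, hx, fun k => (q k).1, rfl⟩, fun k => (q k).2, ?_⟩
      funext j
      by_cases hj : j ∈ range e
      · obtain ⟨⟨k, b⟩, rfl⟩ := hj
        simp only [F, glue_apply, Prod.mk.eta, hq]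
      · simp only [F, glue_apply_of_notMem e _ _ hj]

end Grid

theorem sum_natDist_eq_one_iff {l t : ℕ} (u v : Fin t → Fin l) :
    ∑ k, Nat.dist (u k) (v k) = 1 ↔ ((SimpleGraph.pathGraph l).cartesianPower t).Adj u v := by
  classical
  simp only [SimpleGraph.cartesianPower, SimpleGraph.pathGraph_adj]
  constructor
  · intro h
    obtain ⟨i, -, hi⟩ := Finset.exists_ne_zero_of_sum_ne_zero (h.trans_ne one_ne_zero)
    have h1 := Finset.add_sum_erase Finset.univ (fun k => Nat.dist (u k) (v k)) (Finset.mem_univ i)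
    refine ⟨i, ?_, fun j hj => ?_⟩
    · simp only [Nat.dist] at hi h1 h; omega
    · have h2 : ∑ k ∈ Finset.univ.erase i, Nat.dist (u k) (v k) = 0 := by omega
      exact Fin.ext (Nat.eq_of_dist_eq_zero
        (Finset.sum_eq_zero_iff.1 h2 j (Finset.mem_erase.2 ⟨hj, Finset.mem_univ _⟩)))
  · rintro ⟨i, hi, h⟩
    rw [Finset.sum_eq_single i]
    · simp only [Nat.dist]; omega
    · intro j _ hj
      rw [h j hj, Nat.dist_self]
    · simp

/-- Adjacency means distance one on both sides, so an isometric embedding has an induced image. -/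
theorem isInducedCopy_of_isometric {n l t : ℕ} {f : (Fin t → Fin l) → Fin n → Bool}
    (hf : ∀ u v, hammingDist (f u) (f v) = ∑ k, Nat.dist (u k) (v k)) :
    (SimpleGraph.hypercube n).IsInducedCopy ((SimpleGraph.pathGraph l).cartesianPower t)
      (range f) := by
  have hinj : Injective f := by
    intro u v h
    have h1 := hf u v
    rw [h, hammingDist_self] at h1
    funext k
    exact Fin.ext (Nat.eq_of_dist_eq_zero (Finset.sum_eq_zero_iff.1 h1.symm k (Finset.mem_univ _)))
  refine ⟨SimpleGraph.Iso.symm ⟨Equiv.ofInjective f hinj, ?_⟩⟩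
  intro u v
  rw [← sum_natDist_eq_one_iff, ← hf]
  rfl

/-! ### Counting functions of small support. -/

section Count

variable {K W : Type*} [Fintype K] [Fintype W] [Nonempty K]

/-- Such a function is recovered from a list of `t - 1` pairs (argument, value) that includes its
whole support. -/
theorem card_support_lt_le [DecidableEq K] [DecidableEq W] (w₀ : W) (t : ℕ) :
    (Finset.univ.filter fun z : K → W => (Finset.univ.filter fun k => z k ≠ w₀).card < t).card ≤
      (Fintype.card K * Fintype.card W) ^ (t - 1) := by
  classical
  let F : (Fin (t - 1) → K × W) → K → W := fun s k =>
    if h : ∃ i, (s i).1 = k then (s h.choose).2 else w₀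
  have : (Finset.univ.filter fun z : K → W =>
      (Finset.univ.filter fun k => z k ≠ w₀).card < t) ⊆ Finset.univ.image F := by
    intro z hz
    have hz := (Finset.mem_filter.1 hz).2
    let S := Finset.univ.filter fun k => z k ≠ w₀
    let g : Fin (t - 1) → K := fun i =>
      -- Padding by an arbitrary argument is harmless, as the true value there is recorded.
      if h : (i : ℕ) < S.card then S.equivFin.symm ⟨i, h⟩ else Classical.arbitrary K
    have hg : ∀ k, z k ≠ w₀ → ∃ i, g i = k := by
      intro k hk
      have hkS : k ∈ S := Finset.mem_filter.2 ⟨Finset.mem_univ _, hk⟩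
      have hlt := (S.equivFin ⟨k, hkS⟩).2
      have hSt : S.card < t := hz
      refine ⟨⟨S.equivFin ⟨k, hkS⟩, by omega⟩, ?_⟩
      simp [g]
    refine Finset.mem_image.2 ⟨fun i => (g i, z (g i)), Finset.mem_univ _, ?_⟩
    funext k
    simp only [F]
    split_ifs with h
    · rw [h.choose_spec]
    · by_contra hk
      exact h (hg k (Ne.symm hk))
  refine (Finset.card_le_card this).trans (Finset.card_image_le.trans ?_)
  simp

end Count

/-! ### Splitting the coordinates into blocks. -/

section Blocks

variable {N m t n : ℕ} {C R : Type}
  (E : Fin n ≃ (Fin N × Fin m) ⊕ (Fin t × C) ⊕ R)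

/-- The indices of the blocks `Fin m` of coordinates on which `x` does not vanish. -/
def blockSupport (x : Fin n → Bool) : Finset (Fin N) :=
  Finset.univ.filter fun k => ∃ a, x (E.symm (Sum.inl (k, a))) = true

theorem mem_blockSupport {x : Fin n → Bool} {k : Fin N} :
    k ∈ blockSupport E x ↔ ∃ a, x (E.symm (Sum.inl (k, a))) = true := by
  simp [blockSupport]

/-- The blocks with indices `κ`, each joined with a copy of the coordinates `C`. -/
def blockEmbedding (κ : Fin t ↪ Fin N) : Fin t × (Fin m ⊕ C) ↪ Fin n where
  toFun x := E.symm (x.2.elim (fun a => Sum.inl (κ x.1, a)) fun c => Sum.inr (Sum.inl (x.1, c)))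
  inj' := by
    rintro ⟨k, a | c⟩ ⟨k', a' | c'⟩ h
    · simpa using h
    · simp at h
    · simp at h
    · simpa using h

variable [Fintype C]

/-- Replacing `t` nonzero blocks by nonzero ones leaves the support unchanged, so
`PathTileable.gridTileable` applies. -/
theorem gridTileable_blockSupport_eq {l : ℕ} (hU : PathTileable l (nonzeroOn (Fin m) C))
    {D : Finset (Fin N)} (hD : t ≤ D.card) :
    GridTileable l t {x | blockSupport E x = D} := by
  obtain ⟨κ⟩ : Nonempty (Fin t ↪ D) :=
    Function.Embedding.nonempty_of_card_le (by simpa using hD)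
  let κ' : Fin t ↪ Fin N := κ.trans (Embedding.subtype _)
  have hE : ∀ k a, blockEmbedding E κ' (k, Sum.inl a) = E.symm (Sum.inl ((κ k).1, a)) :=
    fun _ _ => rfl
  refine hU.gridTileable (blockEmbedding E κ') ?_ ?_
  · intro x hx k
    have hx' : blockSupport E x = D := hx
    have hk : (κ k).1 ∈ blockSupport E x := hx' ▸ (κ k).2
    obtain ⟨a, ha⟩ := (mem_blockSupport E).1 hk
    exact ⟨a, (congrArg x (hE k a)).trans ha⟩
  · intro x hx w hw
    have hx' : blockSupport E x = D := hx
    refine Eq.trans ?_ hx'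
    ext k
    by_cases hk : ∃ s, (κ s).1 = k
    · obtain ⟨s, rfl⟩ := hk
      refine iff_of_true ?_ (hx' ▸ (κ s).2)
      obtain ⟨a, ha⟩ := hw s
      exact (mem_blockSupport E).2 ⟨a, by rw [← hE, glue_apply, ha]⟩
    · rw [mem_blockSupport, mem_blockSupport]
      refine exists_congr fun a => ?_
      rw [glue_apply_of_notMem]
      rintro ⟨⟨s, b | c⟩, h⟩
      · have := E.symm.injective h
        simp at this
        exact hk ⟨s, this.1⟩
      · have := E.symm.injective h
        simp at this

theorem gridTileable_le_card_blockSupport {l : ℕ} (hU : PathTileable l (nonzeroOn (Fin m) C)) :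
    GridTileable l t {x | t ≤ (blockSupport E x).card} := by
  convert GridTileable.iUnion (fun D : {D : Finset (Fin N) // t ≤ D.card} =>
    gridTileable_blockSupport_eq E hU D.2) ?_ using 1
  · ext x
    simp
  · intro D D' x h h'
    exact Subtype.ext (h.symm.trans h')

theorem card_blockSupport_lt_le [Fintype R] (hN : 1 ≤ N) :
    (Finset.univ.filter fun x => (blockSupport E x).card < t).card ≤
      (N * 2 ^ m) ^ (t - 1) * 2 ^ (t * Fintype.card C + Fintype.card R) := by
  classical
  have : Nonempty (Fin N) := ⟨⟨0, hN⟩⟩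
  let Φ : (Fin n → Bool) → (Fin N → Fin m → Bool) × ((Fin t × C) ⊕ R → Bool) := fun x =>
    (fun k a => x (E.symm (Sum.inl (k, a))), fun b => x (E.symm (Sum.inr b)))
  have hΦ : Injective Φ := by
    intro x y h
    obtain ⟨h1, h2⟩ := Prod.mk.inj h
    funext i
    obtain ⟨b, rfl⟩ := E.symm.surjective i
    rcases b with ⟨k, a⟩ | b
    · exact congrFun (congrFun h1 k) a
    · exact congrFun h2 b
  have h := card_support_lt_le (K := Fin N) (fun _ : Fin m => false) t
  rw [Fintype.card_fin, Fintype.card_fun, Fintype.card_bool, Fintype.card_fin] at h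
  have hR : Fintype.card ((Fin t × C) ⊕ R → Bool) =
      2 ^ (t * Fintype.card C + Fintype.card R) := by simp
  rw [← hR, ← Finset.card_univ]
  refine le_trans ?_ (Nat.mul_le_mul_right _ h)
  rw [← Finset.card_product]
  refine Finset.card_le_card_of_injOn Φ ?_ hΦ.injOn
  intro x hx
  have hx := (Finset.mem_filter.1 hx).2
  refine Finset.mem_product.2 ⟨Finset.mem_filter.2 ⟨Finset.mem_univ _, ?_⟩, Finset.mem_univ _⟩
  convert hx using 2
  ext k
  rw [mem_blockSupport]
  simp [Φ, funext_iff]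

end Blocks

theorem GridTileable.exists_isInducedPacking {n l t : ℕ} {S : Set (Fin n → Bool)}
    (hS : GridTileable l t S) :
    ∃ P : Set (Set (Fin n → Bool)), (SimpleGraph.hypercube n).IsInducedPacking
      ((SimpleGraph.pathGraph l).cartesianPower t) P ∧ ⋃₀ P = S := by
  obtain ⟨P, hP, hd, hu⟩ := hS
  refine ⟨P, ⟨fun s hs => ?_, hd⟩, hu⟩
  obtain ⟨f, hf, rfl⟩ := hP s hs
  exact isInducedCopy_of_isometric hf

end CubePacking

theorem theorem2p2 (l t : ℕ) (hl : 1 ≤ l) (ht : 1 ≤ t) :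
    ∃ C : ℕ, ∀ n : ℕ, 1 ≤ n →
      ∃ P : Set (Set (Fin n → Bool)),
        (SimpleGraph.hypercube n).IsInducedPacking
            ((SimpleGraph.pathGraph l).cartesianPower t) P ∧
          ((⋃₀ P)ᶜ : Set (Fin n → Bool)).ncard ≤ C * n ^ (t - 1) := by
  obtain ⟨m, C, _, hm, hU⟩ := exists_pathTileable_nonzeroOn l hl
  let c := Fintype.card C
  -- The first summand covers `n < m + t * c`, where the packing is empty; the second bounds the
  -- vertices with fewer than `t` nonzero blocks, with the leftover `r` coordinates bounded by `m`.
  refine ⟨2 ^ (m + t * c) + (2 ^ m) ^ (t - 1) * 2 ^ (t * c + m), fun n hn => ?_⟩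
  rcases lt_or_ge n (m + t * c) with hlt | hge
  · refine ⟨∅, ⟨fun s hs => hs.elim, Set.pairwiseDisjoint_empty⟩, ?_⟩
    have h1 : ((⋃₀ ∅)ᶜ : Set (Fin n → Bool)).ncard = 2 ^ n := by
      simp [Set.ncard_univ]
    rw [h1]
    calc 2 ^ n ≤ 2 ^ (m + t * c) := Nat.pow_le_pow_right (by norm_num) hlt.le
      _ ≤ 2 ^ (m + t * c) + (2 ^ m) ^ (t - 1) * 2 ^ (t * c + m) := Nat.le_add_right _ _
      _ ≤ _ := Nat.le_mul_of_pos_right _ (Nat.pow_pos hn)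
  · let N := (n - t * c) / m
    let r := (n - t * c) % m
    have hN : 1 ≤ N := (Nat.one_le_div_iff hm).2 (by omega)
    have hr : r < m := Nat.mod_lt _ hm
    have hNr : m * N + r = n - t * c := Nat.div_add_mod _ _
    have hNn : N ≤ n := (Nat.div_le_self _ _).trans (Nat.sub_le _ _)
    have hcard : Fintype.card (Fin n) =
        Fintype.card ((Fin N × Fin m) ⊕ (Fin t × C) ⊕ Fin r) := by
      simp only [Fintype.card_sum, Fintype.card_prod, Fintype.card_fin]
      rw [mul_comm N m]
      change n = m * N + (t * c + r)
      omega
    let E := Fintype.equivOfCardEq hcard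
    obtain ⟨P, hP, hu⟩ := (gridTileable_le_card_blockSupport E hU).exists_isInducedPacking
    refine ⟨P, hP, ?_⟩
    have h1 : ((⋃₀ P)ᶜ : Set (Fin n → Bool)) =
        ((Finset.univ.filter fun x => (blockSupport E x).card < t : Finset _) : Set _) := by
      rw [hu]
      ext x
      simp
    rw [h1, Set.ncard_coe_finset]
    refine (card_blockSupport_lt_le E hN).trans ?_
    rw [Fintype.card_fin, mul_pow]
    calc N ^ (t - 1) * (2 ^ m) ^ (t - 1) * 2 ^ (t * c + r)
        ≤ n ^ (t - 1) * (2 ^ m) ^ (t - 1) * 2 ^ (t * c + m) := by gcongr; norm_num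
      _ = (2 ^ m) ^ (t - 1) * 2 ^ (t * c + m) * n ^ (t - 1) := by ring
      _ ≤ _ := Nat.mul_le_mul_right _ (Nat.le_add_left _ _)
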